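/- Let $\mathcal{E}$ be the category of all $\mathbb{F}_2$-vector spaces. A quadratic space is a finite dimensional $\mathbb{F}_2$-vector space $V$ with a function $q\colon V\to\mathbb{F}_2$ such that $B(x,y)=q(x+y)+q(x)+q(y)$ is bilinear; it is non-degenerate if $\{v : B(v,w)=0 \text{ for all } w\in V\}=0$. Let $\mathcal{E}_q$ be the category of non-degenerate quadratic spaces and linear maps preserving the quadratic forms (such maps are injective), and let $\mathcal{E}_q^{\mathrm{deg}}$ be the category of all (possibly degenerate) quadratic spaces and injective linear maps preserving the quadratic forms; the latter has pullbacks. For $f\colon W\to X$ and $g\colon W\to Y$ in $\mathcal{E}_q$, the pseudo push-out $X\underset{W}{\bot}Y$ is the orthogonal sum $W\bot f(W)^{\perp}\bot g(W)^{\perp}$, with the maps from $X\simeq W\bot f(W)^\perp$ and $Y\simeq W\bot g(W)^\perp$. Let $\mathcal{T}_q$ be the category with the objects of $\mathcal{E}_q$ whose morphisms $V\to W$ are the classes $[V\to X\leftarrow W]$ of diagrams in $\mathcal{E}_q$ for the equivalence relation generated by identifying $V\to X_1\leftarrow W$ with $V\to X_2\leftarrow W$ whenever there is a morphism $X_1\to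 X_2$ of $\mathcal{E}_q$ compatible with the maps from $V$ and $W$; the composite of $[U\to X\leftarrow V]$ and $[V\to Y\leftarrow W]$ is $[U\to X\underset{V}{\bot}Y\leftarrow W]$. Let $\mathrm{Sp}(\mathcal{E}_q^{\mathrm{deg}})$ be the category with the objects of $\mathcal{E}_q^{\mathrm{deg}}$ whose morphisms $V\to W$ are the isomorphism classes $[V\leftarrow D\to W]$ of diagrams in $\mathcal{E}_q^{\mathrm{deg}}$, composed by pullback, and let $\mathcal{S}_q$ be its full subcategory on the non-degenerate spaces. Let $\sigma\colon\mathcal{T}_q\to\mathcal{S}_q$ be the functor with $\sigma(V)=V$ and $\sigma([V\to X\leftarrow W])=[V\leftarrow V\underset{X}{\times}W\to W]$, the pullback being taken in $\mathcal{E}_q^{\mathrm{deg}}$. Let $\mathcal{F}_{quad}$ be the category of functors $\mathcal{T}_q\to\mathcal{E}$ and $\mathcal{F}_{iso}$ the category of functors $\mathrm{Sp}(\mathcal{E}_q^{\mathrm{deg}})\to\mathcal{E}$, both with the pointwise tensor product of vector spaces. **Theorem 4.1.** Let $\kappa\colon\mathcal{F}_{iso}\to\mathcal{F}_{quad}$ be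 the functor $F\mapsto F|_{\mathcal{S}_q}\circ\sigma$. Then: 1. $\kappa$ is exact (it is additive and preserves finite limits and finite colimits); 2. $\kappa$ preserves tensor products (it admits the structure of a strong symmetric monoidal functor); 3. $\kappa$ is fully faithful; 4. if $S$ is a simple object of $\mathcal{F}_{iso}$, then $\kappa(S)$ is a simple object of $\mathcal{F}_{quad}$. -/

import Mathlib

open CategoryTheory Limits

noncomputable section

/-! ### The category of spans -/

/-- The category `Sp(C)` of spans in a category `C` with pullbacks: it has the objects of `C`. -/
structure SpanCat (C : Type*) where
  /-- The object of `Sp(C)` given by an object of `C`. -/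
  of ::
  /-- The underlying object of `C`. -/
  base : C

namespace SpanCat

universe v u

variable {C : Type u} [Category.{v} C]

/-- A diagram `X ⟵ D ⟶ Y` in `C` (no condition is put on the two legs). -/
abbrev Diagram (X Y : C) := Span (⊤ : MorphismProperty C) (⊤ : MorphismProperty C) X Y

/-- The diagram with given legs. -/
@[simps]
def diagram {X Y D : C} (l : D ⟶ X) (r : D ⟶ Y) : Diagram X Y := ⟨D, l, r, trivial, trivial⟩

/-- A morphism of `Sp(C)` is an isomorphism class of diagrams `X ⟵ D ⟶ Y`, an isomorphism of
diagrams being an isomorphism of the apices that is compatible with the legs. -/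
def Hom (X Y : SpanCat C) := Quotient (isIsomorphicSetoid (Diagram X.base Y.base))

/-- The class `[X ⟵ D ⟶ Y]`. -/
def cls {X Y D : C} (l : D ⟶ X) (r : D ⟶ Y) : Hom (of X) (of Y) := Quotient.mk _ (diagram l r)

theorem cls_eq_cls {X Y D D' : C} {l : D ⟶ X} {r : D ⟶ Y} {l' : D' ⟶ X} {r' : D' ⟶ Y}
    (e : D ≅ D') (hl : e.hom ≫ l' = l) (hr : e.hom ≫ r' = r) : cls l r = cls l' r' :=
  Quotient.sound ⟨Span.mkIso e hl hr⟩

theorem cls_eq_of_isPullback {X Y A D D' : C} {f : X ⟶ A} {g : Y ⟶ A} {l : D ⟶ X} {r : D ⟶ Y}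
    {l' : D' ⟶ X} {r' : D' ⟶ Y} (h : IsPullback l r f g) (h' : IsPullback l' r' f g)
    {Z : C} (a : X ⟶ Z) {Z' : C} (b : Y ⟶ Z') : cls (l ≫ a) (r ≫ b) = cls (l' ≫ a) (r' ≫ b) :=
  cls_eq_cls (h.isoIsPullback _ _ h') (by simp) (by simp)

theorem Hom.ind {X Y : SpanCat C} {P : Hom X Y → Prop}
    (h : ∀ (D : C) (l : D ⟶ X.base) (r : D ⟶ Y.base), P (cls l r)) (S : Hom X Y) : P S :=
  Quotient.ind (fun S => h S.apex S.l S.r) S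

variable [HasPullbacks C]

/-- Composition: `[Y ⟵ E ⟶ Z] ∘ [X ⟵ D ⟶ Y] = [X ⟵ D ×[Y] E ⟶ Z]`. -/
def comp {X Y Z : SpanCat C} (S : Hom X Y) (T : Hom Y Z) : Hom X Z :=
  Quotient.map₂ (fun S T => diagram (pullback.fst S.r T.l ≫ S.l) (pullback.snd S.r T.l ≫ T.r))
    (by
      rintro S S' ⟨e⟩ T T' ⟨e'⟩
      have h : IsPullback (pullback.fst S.r T.l ≫ e.hom.hom) (pullback.snd S.r T.l ≫ e'.hom.hom)
          S'.r T'.l :=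
        (IsPullback.of_hasPullback S.r T.l).of_iso (Iso.refl _)
          ⟨e.hom.hom, e.inv.hom, by rw [← Span.comp_hom]; simp, by rw [← Span.comp_hom]; simp⟩
          ⟨e'.hom.hom, e'.inv.hom, by rw [← Span.comp_hom]; simp, by rw [← Span.comp_hom]; simp⟩
          (Iso.refl _)
          (by simp) (by simp) (by simp) (by simp)
      have := cls_eq_of_isPullback h (IsPullback.of_hasPullback S'.r T'.l) S'.l T'.r
      simp only [Category.assoc, Span.Hom.hom_l, Span.Hom.hom_r] at this
      exact Quotient.exact this) S T

theorem comp_eq_of_isPullback {X Y Z D E P : C} {l : D ⟶ X} {r : D ⟶ Y} {l' : E ⟶ Y} {r' : E ⟶ Z}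
    {p : P ⟶ D} {q : P ⟶ E} (h : IsPullback p q r l') :
    comp (cls l r) (cls l' r') = cls (p ≫ l) (q ≫ r') :=
  cls_eq_of_isPullback (IsPullback.of_hasPullback r l') h l r'

instance : Category (SpanCat C) where
  Hom := Hom
  id X := cls (𝟙 X.base) (𝟙 X.base)
  comp := comp
  id_comp {X Y} S := by
    induction S using Hom.ind with
    | h D l r =>
      refine (comp_eq_of_isPullback (IsPullback.of_vert_isIso (fst := l) (snd := 𝟙 D) ⟨by simp⟩)).trans ?_
      simp
  comp_id {X Y} S := by
    induction S using Hom.ind with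
    | h D l r =>
      refine (comp_eq_of_isPullback (IsPullback.of_horiz_isIso (fst := 𝟙 D) (snd := r) ⟨by simp⟩)).trans ?_
      simp
  assoc {W X Y Z} S T U := by
    induction S using Hom.ind with
    | h D l r =>
    induction T using Hom.ind with
    | h D' l' r' =>
    induction U using Hom.ind with
    | h D'' l'' r'' =>
      have h₁ := IsPullback.of_hasPullback r l'
      have h₂ := IsPullback.of_hasPullback r' l''
      have h₃ := IsPullback.of_hasPullback (pullback.snd r l') (pullback.fst r' l'')
      refine ((congrArg₂ comp (comp_eq_of_isPullback h₁) rfl).trans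
        (comp_eq_of_isPullback (h₃.paste_vert h₂))).trans ?_
      refine Eq.trans ?_ ((congrArg₂ comp rfl (comp_eq_of_isPullback h₂)).trans
        (comp_eq_of_isPullback (h₃.paste_horiz h₁))).symm
      simp

end SpanCat

/-! ### Quadratic spaces over `𝔽₂` -/

/-- A finite dimensional `𝔽₂`-vector space with a (possibly degenerate) quadratic form: the objects
of `E_q^deg`. -/
structure QSpace where
  /-- The underlying vector space. -/
  carrier : Type
  [addCommGroup : AddCommGroup carrier]
  [module : Module (ZMod 2) carrier]
  [finite : Module.Finite (ZMod 2) carrier]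
  /-- The quadratic form. -/
  form : QuadraticForm (ZMod 2) carrier

namespace QSpace

instance : CoeSort QSpace Type := ⟨carrier⟩

attribute [instance] addCommGroup module finite

/-- The associated bilinear form `B(x, y) = q(x + y) + q(x) + q(y)`. -/
abbrev bil (V : QSpace) : LinearMap.BilinForm (ZMod 2) V := V.form.polarBilin

theorem bil_apply (V : QSpace) (x y : V) : V.bil x y = V.form (x + y) + V.form x + V.form y := by
  simp [bil, QuadraticMap.polar, CharTwo.sub_eq_add]

/-- A quadratic space is non-degenerate if its radical is zero. -/
def Nondeg (V : QSpace) : Prop := ∀ v : V, (∀ w : V, V.bil v w = 0) → v = 0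

/-- A morphism of `E_q^deg`: an injective linear map that preserves the quadratic forms. -/
@[ext]
structure Hom (V W : QSpace) where
  /-- The underlying linear map, which preserves the forms. -/
  isometry : V.form →qᵢ W.form
  injective : Function.Injective isometry

/-- The category `E_q^deg`. -/
instance : Category QSpace where
  Hom := Hom
  id V := ⟨.id V.form, Function.injective_id⟩
  comp f g := ⟨g.isometry.comp f.isometry, g.injective.comp f.injective⟩

instance (V W : QSpace) : FunLike (V ⟶ W) V W where
  coe f := f.isometry
  coe_injective _ _ h := Hom.ext (DFunLike.coe_injective h)

instance (V W : QSpace) : LinearMapClass (V ⟶ W) (ZMod 2) V W where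
  map_add f := map_add f.isometry
  map_smulₛₗ f := map_smul f.isometry

@[ext]
theorem hom_ext {V W : QSpace} {f g : V ⟶ W} (h : ∀ x, f x = g x) : f = g := DFunLike.ext _ _ h

@[simp] theorem id_apply (V : QSpace) (x : V) : (𝟙 V : V ⟶ V) x = x := rfl

@[simp] theorem comp_apply {U V W : QSpace} (f : U ⟶ V) (g : V ⟶ W) (x : U) :
    (f ≫ g) x = g (f x) := rfl

theorem hom_injective {V W : QSpace} (f : V ⟶ W) : Function.Injective f := f.injective

@[simp] theorem form_map {V W : QSpace} (f : V ⟶ W) (x : V) : W.form (f x) = V.form x :=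
  f.isometry.map_app x

/-- The restriction of the quadratic form to a subspace. -/
abbrev sub (V : QSpace) (S : Submodule (ZMod 2) V) : QSpace := ⟨S, V.form.comp S.subtype⟩

/-- The orthogonal sum. -/
abbrev osum (V W : QSpace) : QSpace := ⟨V × W, V.form.prod W.form⟩

/-- A pullback in `E_q^deg` is a pullback of the underlying sets. -/
theorem isPullback_of {P X Y Z : QSpace} {p : P ⟶ X} {q : P ⟶ Y} {f : X ⟶ Z} {g : Y ⟶ Z}
    (w : p ≫ f = q ≫ g) (h : ∀ x y, f x = g y → ∃ z, p z = x ∧ q z = y) : IsPullback p q f g := by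
  have key : ∀ s : PullbackCone f g, ∃ l : s.pt ⟶ P, l ≫ p = s.fst ∧ l ≫ q = s.snd := by
    intro s
    have hs : ∀ x, ∃ z, p z = s.fst x ∧ q z = s.snd x := fun x =>
      h _ _ (by simpa using DFunLike.congr_fun s.condition x)
    choose l hl hl' using hs
    let L : s.pt ⟶ P :=
      { isometry :=
          { toFun := l
            map_add' := fun x y => hom_injective p (by simp [hl])
            map_smul' := fun c x => hom_injective p (by simp [hl])
            map_app' := fun x => by
              change P.form (l x) = _
              rw [← form_map p, hl, form_map] }
        injective := fun x y hxy => hom_injective s.fst (by rw [← hl, ← hl]; exact congrArg p hxy) }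
    exact ⟨L, hom_ext hl, hom_ext hl'⟩
  refine ⟨⟨w⟩, ⟨PullbackCone.IsLimit.mk w (fun s => (key s).choose)
    (fun s => (key s).choose_spec.1) (fun s => (key s).choose_spec.2) ?_⟩⟩
  intro s m hm _
  ext x
  apply hom_injective p
  rw [← comp_apply, ← comp_apply, hm, (key s).choose_spec.1]

/-- The inclusion of a subspace. -/
def subι (V : QSpace) (S : Submodule (ZMod 2) V) : V.sub S ⟶ V where
  isometry := { S.subtype with map_app' := fun _ => rfl }
  injective := S.injective_subtype

/-- `E_q^deg` admits pullbacks. -/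
instance : HasPullbacks QSpace := by
  have : ∀ {X Y Z : QSpace} (f : X ⟶ Z) (g : Y ⟶ Z), HasLimit (cospan f g) := by
    intro X Y Z f g
    let S : Submodule (ZMod 2) X :=
      (LinearMap.range g.isometry.toLinearMap).comap f.isometry.toLinearMap
    have hS : ∀ x : S, ∃ y : Y, g y = f x.1 := fun x => x.2
    choose r hr using hS
    let R : X.sub S ⟶ Y :=
      { isometry :=
          { toFun := r
            map_add' := fun x y => hom_injective g (by simp [hr])
            map_smul' := fun c x => hom_injective g (by simp [hr])
            map_app' := fun x => by
              change Y.form (r x) = X.form x.1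
              rw [← form_map g, hr, form_map] }
        injective := fun x y hxy => Subtype.ext (hom_injective f (by
          rw [← hr, ← hr]; exact congrArg g hxy)) }
    exact (isPullback_of (p := X.subι S) (q := R) (hom_ext fun x => (hr x).symm)
      (fun x y hxy => ⟨⟨x, y, hxy.symm⟩, rfl, hom_injective g ((hr _).trans hxy)⟩)).hasPullback
  exact hasPullbacks_of_hasLimit_cospan _

theorem bil_comm (V : QSpace) (x y : V) : V.bil x y = V.bil y x := by
  simp [QuadraticMap.polar_comm]

@[simp] theorem bil_self (V : QSpace) (x : V) : V.bil x x = 0 := by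
  simp [CharTwo.two_eq_zero]

theorem form_add (V : QSpace) (x y : V) : V.form (x + y) = V.form x + V.form y + V.bil x y := by
  simp [QuadraticMap.polar]

theorem Nondeg.injective {V W : QSpace} (hV : V.Nondeg) (f : V.form →qᵢ W.form) :
    Function.Injective f := by
  rw [injective_iff_map_eq_zero]
  intro x hx
  refine hV x fun w => ?_
  rw [bil_apply, ← f.map_app (x + w), ← f.map_app x, ← f.map_app w, map_add, hx, zero_add,
    map_zero, add_zero, CharTwo.add_self_eq_zero]

end QSpace

/-- The objects of `E_q`: the non-degenerate quadratic spaces. -/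
structure NSpace where
  /-- The underlying quadratic space. -/
  toQSpace : QSpace
  nondeg : toQSpace.Nondeg

namespace NSpace

/-- The category `E_q`: its morphisms are the linear maps that preserve the quadratic forms. -/
instance : Category NSpace where
  Hom V W := V.toQSpace.form →qᵢ W.toQSpace.form
  id V := .id _
  comp f g := g.comp f

instance : CoeSort NSpace Type := ⟨fun V => V.toQSpace⟩

/-- The inclusion of `E_q` in `E_q^deg` (the morphisms of `E_q` are injective). -/
def incl : NSpace ⥤ QSpace where
  obj V := V.toQSpace
  map {V W} f := ⟨f, V.nondeg.injective f⟩

end NSpace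

namespace NSpace

instance (V W : NSpace) : FunLike (V ⟶ W) V W :=
  inferInstanceAs (FunLike (V.toQSpace.form →qᵢ W.toQSpace.form) V W)

instance (V W : NSpace) : LinearMapClass (V ⟶ W) (ZMod 2) V W :=
  inferInstanceAs (LinearMapClass (V.toQSpace.form →qᵢ W.toQSpace.form) (ZMod 2) V W)

@[ext]
theorem hom_ext {V W : NSpace} {f g : V ⟶ W} (h : ∀ x, f x = g x) : f = g := DFunLike.ext _ _ h

@[simp] theorem id_apply (V : NSpace) (x : V) : (𝟙 V : V ⟶ V) x = x := rfl

@[simp] theorem comp_apply {U V W : NSpace} (f : U ⟶ V) (g : V ⟶ W) (x : U) :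
    (f ≫ g) x = g (f x) := rfl

@[simp] theorem incl_map_apply {V W : NSpace} (f : V ⟶ W) (x : V) : incl.map f x = f x := rfl

/-- The quadratic form. -/
abbrev form (V : NSpace) : QuadraticForm (ZMod 2) V := V.toQSpace.form

/-- The associated bilinear form. -/
abbrev bil (V : NSpace) : LinearMap.BilinForm (ZMod 2) V := V.toQSpace.bil

@[simp] theorem form_map {V W : NSpace} (f : V ⟶ W) (x : V) : W.form (f x) = V.form x :=
  QuadraticMap.Isometry.map_app (Q₁ := V.form) (Q₂ := W.form) f x

theorem bil_map {V W : NSpace} (f : V ⟶ W) (x y : V) : W.bil (f x) (f y) = V.bil x y := by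
  rw [QSpace.bil_apply, QSpace.bil_apply, ← map_add f]
  exact congrArg₂ _ (congrArg₂ _ (form_map f _) (form_map f _)) (form_map f _)

variable {W X Y P : NSpace}

/-- The orthogonal space of the image of `f`, as a subspace. -/
def perp (f : W ⟶ X) : Submodule (ZMod 2) X where
  carrier := {x | ∀ w : W, X.bil x (f w) = 0}
  add_mem' hx hy w := by rw [map_add, LinearMap.add_apply, hx w, hy w, add_zero]
  zero_mem' w := by rw [map_zero, LinearMap.zero_apply]
  smul_mem' c x hx w := by rw [map_smul, LinearMap.smul_apply, hx w, smul_zero]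

theorem bil_nondegenerate (W : NSpace) : W.bil.Nondegenerate :=
  ⟨W.nondeg, fun y hy => W.nondeg y fun x => (QSpace.bil_comm _ _ _).trans (hy x)⟩

/-- The orthogonal projection `X → W` along `f : W ⟶ X`. -/
def proj (f : W ⟶ X) : X →ₗ[ZMod 2] W :=
  (W.bil.toDual W.bil_nondegenerate).symm.toLinearMap ∘ₗ
    X.bil.compl₂ (QuadraticMap.Isometry.toLinearMap (Q₁ := W.form) (Q₂ := X.form) f)

theorem bil_proj (f : W ⟶ X) (x : X) (w : W) : W.bil (proj f x) w = X.bil x (f w) :=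
  LinearMap.BilinForm.apply_toDual_symm_apply (hB := W.bil_nondegenerate) _ w

theorem proj_eq (f : W ⟶ X) {x : X} {w : W} (h : ∀ w', W.bil w w' = X.bil x (f w')) :
    proj f x = w :=
  sub_eq_zero.1 (W.nondeg _ fun w' => by
    rw [map_sub, LinearMap.sub_apply, bil_proj, h, sub_self])

@[simp] theorem proj_map (f : W ⟶ X) (w : W) : proj f (f w) = w :=
  proj_eq f fun w' => (bil_map f w w').symm

theorem proj_eq_zero (f : W ⟶ X) {x : X} (hx : x ∈ perp f) : proj f x = 0 :=
  proj_eq f fun w' => by rw [hx w', map_zero, LinearMap.zero_apply]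

/-- The orthogonal projection `X → f(W)^⊥`. -/
def coproj (f : W ⟶ X) : X →ₗ[ZMod 2] perp f where
  toFun x := ⟨x - f (proj f x), fun w => by
    rw [map_sub, LinearMap.sub_apply, bil_map, bil_proj, sub_self]⟩
  map_add' x y := Subtype.ext (by simp; abel)
  map_smul' c x := Subtype.ext (by simp [smul_sub])

theorem split (f : W ⟶ X) (x : X) : f (proj f x) + (coproj f x).1 = x := by
  simp [coproj]

theorem coproj_map (f : W ⟶ X) (w : W) : coproj f (f w) = 0 := Subtype.ext (by simp [coproj])

theorem coproj_perp (f : W ⟶ X) (x : perp f) : coproj f x = x :=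
  Subtype.ext (by simp [coproj, proj_eq_zero f x.2])

theorem form_split (f : W ⟶ X) (x : X) :
    W.form (proj f x) + X.form (coproj f x).1 = X.form x := by
  conv_rhs => rw [← split f x]
  rw [form, QSpace.form_add, QSpace.bil_comm, (coproj f x).2, add_zero]
  exact congrArg (· + _) (form_map f _).symm

/-- The pseudo push-out `X ⊥_W Y` of `f : W ⟶ X` and `g : W ⟶ Y`: the orthogonal sum of `W`, of
the orthogonal space of `f(W)` in `X`, and of the orthogonal space of `g(W)` in `Y`. -/
def ppo (f : W ⟶ X) (g : W ⟶ Y) : NSpace where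
  toQSpace := W.toQSpace.osum ((X.toQSpace.sub (perp f)).osum (Y.toQSpace.sub (perp g)))
  nondeg := by
    have perp_nondeg : ∀ {Z : NSpace} (h : W ⟶ Z), (Z.toQSpace.sub (perp h)).Nondeg := by
      intro Z h x hx
      refine Subtype.ext (Z.nondeg _ fun z => ?_)
      rw [← split h z, map_add, x.2, zero_add]
      exact hx _
    rintro ⟨w, x, y⟩ h
    have h₁ : w = 0 := W.nondeg w fun w' => by simpa using! h (w', 0, 0)
    have h₂ : x = 0 := perp_nondeg f x fun x' => by simpa using! h (0, x', 0)
    have h₃ : y = 0 := perp_nondeg g y fun y' => by simpa using! h (0, 0, y')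
    rw [h₁, h₂, h₃]; rfl

/-- The morphism from `X ≃ W ⊥ f(W)^⊥` to the pseudo push-out. -/
def inl (f : W ⟶ X) (g : W ⟶ Y) : X ⟶ ppo f g :=
  { (proj f).prod ((coproj f).prod (0 : X →ₗ[ZMod 2] perp g)) with
    map_app' := fun x => by
      change W.form (proj f x) + (X.form (coproj f x).1 + Y.form 0) = X.form x
      rw [QuadraticMap.map_zero, add_zero, form_split] }

/-- The morphism from `Y ≃ W ⊥ g(W)^⊥` to the pseudo push-out. -/
def inr (f : W ⟶ X) (g : W ⟶ Y) : Y ⟶ ppo f g :=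
  { (proj g).prod ((0 : Y →ₗ[ZMod 2] perp f).prod (coproj g)) with
    map_app' := fun y => by
      change W.form (proj g y) + (X.form 0 + Y.form (coproj g y).1) = Y.form y
      rw [QuadraticMap.map_zero, zero_add, form_split] }

theorem inl_apply (f : W ⟶ X) (g : W ⟶ Y) (x : X) :
    inl f g x = ((proj f x, coproj f x, 0) : W × perp f × perp g) := rfl

theorem inr_apply (f : W ⟶ X) (g : W ⟶ Y) (y : Y) :
    inr f g y = ((proj g y, 0, coproj g y) : W × perp f × perp g) := rfl

theorem condition (f : W ⟶ X) (g : W ⟶ Y) : f ≫ inl f g = g ≫ inr f g := by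
  ext w
  rw [comp_apply, comp_apply, inl_apply, inr_apply, proj_map, proj_map, coproj_map, coproj_map]

theorem inl_orth_inr (f : W ⟶ X) (g : W ⟶ Y) (x : X) (y : perp g) :
    (ppo f g).bil (inl f g x) (inr f g y.1) = 0 := by
  rw [inl_apply, inr_apply, coproj_perp, proj_eq_zero g y.2]
  change QuadraticMap.polar (W.form.prod ((X.form.comp (perp f).subtype).prod
    (Y.form.comp (perp g).subtype))) _ _ = 0
  simp

theorem exists_eq_add (f : W ⟶ X) (g : W ⟶ Y) (z : ppo f g) :
    ∃ (x : X) (y : Y), z = inl f g x + inr f g y := by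
  obtain ⟨w, x, y⟩ : W × perp f × perp g := z
  refine ⟨f w + x.1, y.1, ?_⟩
  rw [inl_apply, inr_apply]
  simp only [map_add, proj_map, coproj_map, coproj_perp, proj_eq_zero f x.2, proj_eq_zero g y.2]
  change ((w, x, y) : W × perp f × perp g) = (w + 0 + 0, 0 + x + 0, 0 + y)
  simp

/-- Any commutative square in which the complement of `W` in `Y` is orthogonal to `X` receives a
morphism from the pseudo push-out. -/
theorem exists_desc {f : W ⟶ X} {g : W ⟶ Y} (a : X ⟶ P) (b : Y ⟶ P) (w : f ≫ a = g ≫ b)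
    (h : ∀ (x : X) (y : perp g), P.bil (a x) (b y.1) = 0) :
    ∃ d : ppo f g ⟶ P, inl f g ≫ d = a ∧ inr f g ≫ d = b := by
  have w' : ∀ z, a (f z) = b (g z) := fun z => DFunLike.congr_fun w z
  let d : ppo f g ⟶ P :=
    { toFun := fun z : W × perp f × perp g => a (f z.1 + z.2.1.1) + b z.2.2.1
      map_add' := fun z z' => by
        change a (f (z.1 + z'.1) + (z.2.1.1 + z'.2.1.1)) + b (z.2.2.1 + z'.2.2.1) = _
        simp only [map_add]
        abel
      map_smul' := fun c z => by
        change a (f (c • z.1) + c • z.2.1.1) + b (c • z.2.2.1) = _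
        simp only [map_add, map_smul, smul_add, RingHom.id_apply]
      map_app' := fun z => by
        change P.form (a (f z.1 + z.2.1.1) + b z.2.2.1) = W.form z.1 + (X.form z.2.1.1 + Y.form z.2.2.1)
        rw [form, QSpace.form_add, h, add_zero]
        change P.form _ + P.form _ = _
        rw [form_map, form_map, form, QSpace.form_add, QSpace.bil_comm, z.2.1.2, add_zero]
        change X.form _ + _ + _ = _
        rw [form_map, add_assoc] }
  refine ⟨d, ?_, ?_⟩
  · ext x
    change a (f (proj f x) + (coproj f x).1) + b 0 = a x
    rw [split, map_zero, add_zero]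
  · ext y
    change a (f (proj g y) + 0) + b (coproj g y).1 = b y
    rw [add_zero, w', ← map_add, split]

theorem isPullback_ppo (f : W ⟶ X) (g : W ⟶ Y) :
    IsPullback (incl.map f) (incl.map g) (incl.map (inl f g)) (incl.map (inr f g)) := by
  refine QSpace.isPullback_of ?_ ?_
  · rw [← incl.map_comp, condition, incl.map_comp]
  · intro x y hxy
    obtain ⟨h₁, h₂⟩ := Prod.ext_iff.1
      (show ((proj f x, coproj f x, 0) : W × perp f × perp g) = (proj g y, 0, coproj g y) from hxy)
    obtain ⟨h₂, h₃⟩ := Prod.ext_iff.1 h₂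
    refine ⟨proj f x, ?_, ?_⟩
    · refine Eq.trans ?_ (split f x)
      rw [show coproj f x = 0 from h₂]; exact (add_zero _).symm
    · refine Eq.trans ?_ (split g y)
      rw [show coproj g y = 0 from h₃.symm, ← show proj f x = proj g y from h₁]
      exact (add_zero _).symm

end NSpace

/-! ### The category `T_q` -/

/-- The category `T_q`: it has the objects of `E_q`. -/
structure TCat where
  /-- The object of `T_q` given by a non-degenerate quadratic space. -/
  of ::
  /-- The underlying non-degenerate quadratic space. -/
  base : NSpace

namespace TCat

open NSpace

/-- A diagram `V ⟶ X ⟵ W` in `E_q`. -/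
structure Diagram (V W : NSpace) where
  /-- The apex. -/
  apex : NSpace
  /-- The left leg. -/
  l : V ⟶ apex
  /-- The right leg. -/
  r : W ⟶ apex

/-- The relation `R`: there is a morphism `α` of `E_q` between the apices, compatible with the
legs. Isomorphic diagrams are related by `R`. -/
def Rel {V W : NSpace} (S T : Diagram V W) : Prop :=
  ∃ α : S.apex ⟶ T.apex, S.l ≫ α = T.l ∧ S.r ≫ α = T.r

/-- A morphism of `T_q` is a class of diagrams `V ⟶ X ⟵ W` for the equivalence relation
generated by `R`. (Passing first to isomorphism classes of diagrams does not change the quotient,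
since `R` contains the isomorphisms of diagrams.) -/
def Hom (V W : TCat) := Quot (Rel (V := V.base) (W := W.base))

/-- The class `[V ⟶ X ⟵ W]`. -/
def cls {V W X : NSpace} (l : V ⟶ X) (r : W ⟶ X) : Hom (of V) (of W) := Quot.mk _ ⟨X, l, r⟩

theorem Hom.ind {V W : TCat} {P : Hom V W → Prop}
    (h : ∀ (X : NSpace) (l : V.base ⟶ X) (r : W.base ⟶ X), P (cls l r)) (S : Hom V W) : P S :=
  Quot.ind (fun S => h S.apex S.l S.r) S

/-- Composition of diagrams: the composite of `U ⟶ X ⟵ V` and `V ⟶ Y ⟵ W` is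
`U ⟶ X ⊥_V Y ⟵ W`. -/
@[simps]
def Diagram.comp {U V W : NSpace} (S : Diagram U V) (T : Diagram V W) : Diagram U W :=
  ⟨ppo S.r T.l, S.l ≫ inl S.r T.l, T.r ≫ inr S.r T.l⟩

theorem rel_comp {U V W X Y P : NSpace} {l : U ⟶ X} {r : V ⟶ X} {l' : V ⟶ Y} {r' : W ⟶ Y}
    (a : X ⟶ P) (b : Y ⟶ P) (w : r ≫ a = l' ≫ b)
    (h : ∀ (x : X) (y : perp l'), P.bil (a x) (b y.1) = 0) :
    Rel (Diagram.comp ⟨X, l, r⟩ ⟨Y, l', r'⟩) ⟨P, l ≫ a, r' ≫ b⟩ := by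
  obtain ⟨d, h₁, h₂⟩ := exists_desc a b w h
  refine ⟨d, ?_, ?_⟩
  · rw [← h₁]; exact Category.assoc _ _ _
  · rw [← h₂]; exact Category.assoc _ _ _

/-- Composition in `T_q`. -/
def comp {U V W : TCat} (S : Hom U V) (T : Hom V W) : Hom U W :=
  Quot.map₂ Diagram.comp
    (by
      rintro ⟨X, l, r⟩ ⟨Y, l', r'⟩ ⟨Y', m, m'⟩ ⟨α, h, h'⟩
      dsimp only at α h h'
      subst h h'
      have := rel_comp (l := l) (r := r) (l' := l') (r' := r')
        (inl r (l' ≫ α)) (α ≫ inr r (l' ≫ α)) (by simp [condition]) (fun x y => by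
          have hy : α y.1 ∈ perp (l' ≫ α) := fun w => by
            rw [comp_apply, bil_map]; exact y.2 w
          exact inl_orth_inr r (l' ≫ α) x ⟨α y.1, hy⟩)
      simpa [Diagram.comp] using this)
    (by
      rintro ⟨X, l, r⟩ ⟨X', m, m'⟩ ⟨Y, l', r'⟩ ⟨α, h, h'⟩
      dsimp only at α h h'
      subst h h'
      have := rel_comp (l := l) (r := r) (l' := l') (r' := r')
        (α ≫ inl (r ≫ α) l') (inr (r ≫ α) l') (by simp [← condition])
        (fun x y => inl_orth_inr (r ≫ α) l' (α x) y)
      simpa [Diagram.comp] using this) S T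

theorem comp_cls {U V W X Y : NSpace} (l : U ⟶ X) (r : V ⟶ X) (l' : V ⟶ Y) (r' : W ⟶ Y) :
    comp (cls l r) (cls l' r') = cls (l ≫ inl r l') (r' ≫ inr r l') := rfl

theorem comp_eq {U V W X Y P : NSpace} {l : U ⟶ X} {r : V ⟶ X} {l' : V ⟶ Y} {r' : W ⟶ Y}
    (a : X ⟶ P) (b : Y ⟶ P) (w : r ≫ a = l' ≫ b)
    (h : ∀ (x : X) (y : perp l'), P.bil (a x) (b y.1) = 0) :
    comp (cls l r) (cls l' r') = cls (l ≫ a) (r' ≫ b) :=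
  Quot.sound (rel_comp a b w h)

theorem comp_assoc {U V W Z X₁ X₂ X₃ : NSpace} (l : U ⟶ X₁) (r : V ⟶ X₁) (l' : V ⟶ X₂)
    (r' : W ⟶ X₂) (l'' : W ⟶ X₃) (r'' : Z ⟶ X₃) :
    comp (comp (cls l r) (cls l' r')) (cls l'' r'') =
      comp (cls l r) (comp (cls l' r') (cls l'' r'')) := by
  rw [comp_cls l' r', comp_cls l r (l' ≫ _), comp_cls l r l' r']
  set i := l' ≫ inl r' l'' with hi
  have hperp : ∀ y : perp l'', inr r' l'' y.1 ∈ perp i := fun y w => by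
    rw [bil, QSpace.bil_comm]
    exact inl_orth_inr r' l'' (l' w) y
  obtain ⟨a, h₁, h₂⟩ := exists_desc (f := r) (g := l') (inl r i) (inl r' l'' ≫ inr r i)
    (by rw [condition r i, hi, Category.assoc]) (fun x y => by
      have hy : inl r' l'' y.1 ∈ perp i := fun w => by
        rw [hi, comp_apply, bil_map]; exact y.2 w
      exact inl_orth_inr r i x ⟨_, hy⟩)
  rw [comp_eq a (inr r' l'' ≫ inr r i)
    (by rw [Category.assoc, h₂, ← Category.assoc, condition r' l'', Category.assoc]) ?_]
  · rw [Category.assoc, h₁, Category.assoc]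
  · intro z y
    obtain ⟨x, x', rfl⟩ := exists_eq_add r l' z
    rw [map_add, map_add, LinearMap.add_apply, ← comp_apply, h₁, ← comp_apply (inr r l') a, h₂]
    have e₁ := inl_orth_inr r i x ⟨_, hperp y⟩
    have e₂ := inl_orth_inr r' l'' x' y
    rw [← bil_map (inr r i)] at e₂
    exact (congrArg₂ (· + ·) e₁ e₂).trans (add_zero 0)

/-- The category `T_q`. -/
instance : Category TCat where
  Hom := Hom
  id V := cls (𝟙 V.base) (𝟙 V.base)
  comp := comp
  id_comp {V W} S := by
    induction S using Hom.ind with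
    | h X l r =>
      refine (comp_eq l (𝟙 X) (by simp) (fun x y => ?_)).trans (by simp)
      rw [bil, QSpace.bil_comm]
      exact y.2 x
  comp_id {V W} S := by
    induction S using Hom.ind with
    | h X l r =>
      refine (comp_eq (𝟙 X) r (by simp) (fun x y => ?_)).trans (by simp)
      rw [W.base.nondeg y.1 y.2, map_zero, map_zero]
  assoc S T U := by
    induction S using Hom.ind with
    | h X₁ l r =>
    induction T using Hom.ind with
    | h X₂ l' r' =>
    induction U using Hom.ind with
    | h X₃ l'' r'' => exact comp_assoc l r l' r' l'' r''

end TCat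

/-! ### The functors `σ` and `κ` -/

/-- The category `S_q`: the full subcategory of `Sp(E_q^deg)` on the non-degenerate spaces. -/
abbrev SCat := ObjectProperty.FullSubcategory (fun V : SpanCat QSpace => V.base.Nondeg)

open NSpace in
/-- The morphism `[V ⟵ V ×[X] W ⟶ W]` of `Sp(E_q^deg)` associated to the class
`[V ⟶ X ⟵ W]`, the pullback being taken in `E_q^deg`. -/
def sigmaMap {V W : TCat} (S : TCat.Hom V W) :
    SpanCat.Hom (.of (incl.obj V.base)) (.of (incl.obj W.base)) :=
  Quot.lift (fun S : TCat.Diagram V.base W.base =>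
      SpanCat.cls (pullback.fst (incl.map S.l) (incl.map S.r))
        (pullback.snd (incl.map S.l) (incl.map S.r)))
    (by
      rintro ⟨X, l, r⟩ ⟨Y, l', r'⟩ ⟨α, h, h'⟩
      dsimp only at α h h'
      subst h h'
      have h₁ : IsPullback (pullback.fst (incl.map l) (incl.map r))
          (pullback.snd (incl.map l) (incl.map r)) (incl.map (l ≫ α)) (incl.map (r ≫ α)) := by
        have : Mono (incl.map α) := ⟨fun u v huv => QSpace.hom_ext fun x =>
          QSpace.hom_injective (incl.map α) (DFunLike.congr_fun huv x)⟩
        refine ⟨⟨by simp [pullback.condition_assoc]⟩, ⟨PullbackCone.IsLimit.mk _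
          (fun s => pullback.lift s.fst s.snd
            (by rw [← cancel_mono (incl.map α)]; simpa using s.condition))
          (fun s => pullback.lift_fst _ _ _) (fun s => pullback.lift_snd _ _ _) ?_⟩⟩
        intro s m h h'
        apply pullback.hom_ext
        · rw [h, pullback.lift_fst]
        · rw [h', pullback.lift_snd]
      have := SpanCat.cls_eq_of_isPullback h₁ (IsPullback.of_hasPullback _ _) (𝟙 _) (𝟙 _)
      simpa using this) S

open NSpace in
theorem sigmaMap_cls {V W X : NSpace} {D : QSpace} {l : V ⟶ X} {r : W ⟶ X} {p : D ⟶ incl.obj V}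
    {q : D ⟶ incl.obj W} (h : IsPullback p q (incl.map l) (incl.map r)) :
    sigmaMap (TCat.cls l r) = SpanCat.cls p q := by
  simpa using! SpanCat.cls_eq_of_isPullback (IsPullback.of_hasPullback _ _) h (𝟙 _) (𝟙 _)

open NSpace in
/-- The functor `σ : T_q ⥤ S_q`, with `σ(V) = V` and
`σ([V ⟶ X ⟵ W]) = [V ⟵ V ×[X] W ⟶ W]`. -/
def sigma : TCat ⥤ SCat where
  obj V := ⟨.of (incl.obj V.base), V.base.nondeg⟩
  map S := ObjectProperty.homMk (sigmaMap S)
  map_id V := ObjectProperty.hom_ext _ (sigmaMap_cls (by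
    rw [incl.map_id]
    exact IsPullback.of_vert_isIso ⟨rfl⟩))
  map_comp {U V W} S T := ObjectProperty.hom_ext _ (by
    induction S using TCat.Hom.ind with
    | h X l r =>
    induction T using TCat.Hom.ind with
    | h Y l' r' =>
      have h₁ := IsPullback.of_hasPullback (incl.map l) (incl.map r)
      have h₂ := IsPullback.of_hasPullback (incl.map l') (incl.map r')
      have h₃ := IsPullback.of_hasPullback
        (pullback.snd (incl.map l) (incl.map r)) (pullback.fst (incl.map l') (incl.map r'))
      have h := (h₃.paste_vert h₂).paste_horiz (h₁.paste_vert (isPullback_ppo r l'))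
      refine (sigmaMap_cls (l := l ≫ inl r l') (r := r' ≫ inr r l') ?_).trans
        ((congrArg₂ SpanCat.comp (sigmaMap_cls h₁) (sigmaMap_cls h₂)).trans
          (SpanCat.comp_eq_of_isPullback h₃)).symm
      simpa using h)

/-! ### The functor categories -/

/-- The category `E` of all `𝔽₂`-vector spaces. -/
abbrev Vect := ModuleCat.{0} (ZMod 2)

/-- `F_quad` is the category of functors from `T_q` to `E`. -/
abbrev Fquad := TCat ⥤ Vect

/-- `F_iso` is the category of functors from `Sp(E_q^deg)` to `E`. -/
abbrev Fiso := SpanCat QSpace ⥤ Vect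

/-- The functor `κ`: restriction to `S_q` followed by precomposition with `σ`. -/
def kappa : Fiso ⥤ Fquad :=
  (Functor.whiskeringLeft SCat (SpanCat QSpace) Vect).obj (ObjectProperty.ι _) ⋙
    (Functor.whiskeringLeft TCat SCat Vect).obj sigma

theorem kappa_obj (F : Fiso) : kappa.obj F = sigma ⋙ ObjectProperty.ι _ ⋙ F := rfl

end

/-! Up to definitional equality `κ` is precomposition with the composite `Φ : T_q ⥤ S_q ⥤
Sp(E_q^deg)`. Exactness and monoidality hold for any precomposition, because limits, colimits, sums
and tensor products of functors are computed pointwise. The other two claims follow formally from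
two facts about `Φ`: it is full, and every object of the target is a retract of some `Φ(c)`. A
natural transformation is then determined by its values on the image of `Φ` and extends from there,
and a subfunctor of `Φ ⋙ S` comes from a subfunctor of `S`.

The two facts rest on constructions with quadratic forms. Over `𝔽₂` every form is `x ↦ b(x, x)` for
a bilinear `b`, so every space embeds in the hyperbolic space on `V* × V` (`exists_hom_nondeg`). An
embedding is a monomorphism, hence its source is a retract of its target in the category of spans
(`spanRetract`). For fullness, a span `V ⟵ D ⟶ W` is realised as a pullback over a possibly
degenerate space (`exists_isPullback`), which is then embedded in a non-degenerate one. -/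

/-! ### Precomposition: monoidality, faithfulness and fullness -/

namespace CategoryTheory.Functor

open MonoidalCategory

universe v₁ v₂ v₃ u₁ u₂ u₃

variable {C : Type u₁} [Category.{v₁} C] {D : Type u₂} [Category.{v₂} D] {A : Type u₃}
  [Category.{v₃} A]

/-- Precomposition with a functor is symmetric monoidal for the pointwise tensor products. -/
theorem nonempty_braided_whiskeringLeft_obj [MonoidalCategory A] [BraidedCategory A] (Φ : C ⥤ D) :
    Nonempty ((whiskeringLeft C D A).obj Φ).Braided := ⟨{
  toMonoidal := CoreMonoidal.toMonoidal
    -- Both sides have the same value at each object, so all structure isomorphisms have identity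
    -- components and the coherence laws become trivial identities in `A`.
    { εIso := NatIso.ofComponents fun _ => Iso.refl _
      μIso := fun _ _ => NatIso.ofComponents fun _ => Iso.refl _
      μIso_hom_natural_left := fun f F => by
        ext X
        exact (Category.comp_id _).trans (Category.id_comp _).symm
      μIso_hom_natural_right := fun f F => by
        ext X
        exact (Category.comp_id _).trans (Category.id_comp _).symm
      associativity := fun F G H => by
        ext X
        change (𝟙 _ ▷ H.obj (Φ.obj X)) ≫ 𝟙 _ ≫ (α_ _ _ _).hom =
          (α_ _ _ _).hom ≫ (F.obj (Φ.obj X) ◁ 𝟙 _) ≫ 𝟙 _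
        simp
      left_unitality := fun F => by
        ext X
        change (λ_ (F.obj (Φ.obj X))).hom =
          (𝟙 _ ▷ F.obj (Φ.obj X)) ≫ 𝟙 _ ≫ (λ_ (F.obj (Φ.obj X))).hom
        simp
      right_unitality := fun F => by
        ext X
        change (ρ_ (F.obj (Φ.obj X))).hom =
          (F.obj (Φ.obj X) ◁ 𝟙 _) ≫ 𝟙 _ ≫ (ρ_ (F.obj (Φ.obj X))).hom
        simp }
  braided := fun F G => by
    ext X
    change 𝟙 _ ≫ _ = _ ≫ 𝟙 _
    exact (Category.id_comp _).trans (Category.comp_id _).symm }⟩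

variable (Φ : C ⥤ D) (hΦ : ∀ d : D, ∃ c : C, Nonempty (Retract d (Φ.obj c)))
include hΦ

/-- Precomposition with a functor such that every object of the target is a retract of an object
in its image is faithful. -/
theorem faithful_whiskeringLeft_obj : ((whiskeringLeft C D A).obj Φ).Faithful where
  map_injective {F G} α β h := by
    ext d
    obtain ⟨c, ⟨ρ⟩⟩ := hΦ d
    have hc : α.app (Φ.obj c) = β.app (Φ.obj c) := NatTrans.congr_app h c
    have : Mono (G.map ρ.i) := (ρ.map G).splitMono.mono
    -- Naturality along the section `d ⟶ Φ(c)` moves the comparison to `Φ(c)`, where the two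
    -- transformations agree.
    rw [← cancel_mono (G.map ρ.i), ← α.naturality, ← β.naturality, hc]

/-- Precomposition with a full functor such that every object of the target is a retract of an
object in its image is full. -/
theorem full_whiskeringLeft_obj [Φ.Full] : ((whiskeringLeft C D A).obj Φ).Full where
  map_surjective {F G} τ := by
    -- By fullness, `τ` is natural for every morphism of `D` between objects of the image, not only
    -- for those given as `Φ(m)`.
    have nat : ∀ {c c' : C} (m : Φ.obj c ⟶ Φ.obj c'),
        F.map m ≫ τ.app c' = τ.app c ≫ G.map m := fun {c c'} m => by
      rw [← Φ.map_preimage m]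
      exact τ.naturality (Φ.preimage m)
    choose c ρ using hΦ
    have ρ := fun d => (ρ d).some
    -- Naturality along the section and the retraction forces this value at `d`.
    refine ⟨{ app := fun d => F.map (ρ d).i ≫ τ.app (c d) ≫ G.map (ρ d).r,
              naturality := fun d e m => ?_ }, ?_⟩
    · have h := nat ((ρ d).r ≫ m ≫ (ρ e).i)
      have h' : τ.app (c d) ≫ G.map ((ρ d).r ≫ m) =
          τ.app (c d) ≫ G.map ((ρ d).r ≫ m ≫ (ρ e).i) ≫ G.map (ρ e).r := by
        rw [← G.map_comp]; simp
      rw [Category.assoc, Category.assoc, ← G.map_comp, h', ← Category.assoc (τ.app _), ← h,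
        ← F.map_comp_assoc, Category.assoc, ← F.map_comp_assoc]
      simp
    · ext x
      change F.map (ρ (Φ.obj x)).i ≫ τ.app _ ≫ G.map (ρ (Φ.obj x)).r = τ.app x
      rw [← nat, ← F.map_comp_assoc]
      simp

end CategoryTheory.Functor

/-! ### Preservation of simple objects -/

namespace CategoryTheory.Functor

universe w v₁ v₂ u₁ u₂ u

variable {C : Type u₁} [Category.{v₁} C] {D : Type u₂} [Category.{v₂} D] {R : Type u} [Ring R]

/-- The largest subfunctor of `S` whose values at the objects `Φ(c)` are contained in the image
of `f`. -/
@[simps]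
def coinducedSubfunctor (Φ : C ⥤ D) {S : D ⥤ ModuleCat.{w} R} {Y : C ⥤ ModuleCat.{w} R}
    (f : Y ⟶ Φ ⋙ S) : D ⥤ ModuleCat.{w} R where
  obj d := ModuleCat.of R
    (⨅ (c : C) (m : d ⟶ Φ.obj c), (LinearMap.range (f.app c).hom).comap (S.map m).hom :
      Submodule R (S.obj d))
  map {d e} n := ModuleCat.ofHom ((S.map n).hom.restrict fun x hx => by
    simp only [Submodule.mem_iInf] at hx ⊢
    intro c m
    simpa using hx c (n ≫ m))
  map_id d := by
    ext x
    exact ConcreteCategory.congr_hom (S.map_id d) x.1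
  map_comp m n := by
    ext x
    exact ConcreteCategory.congr_hom (S.map_comp m n) x.1

/-- The inclusion of `coinducedSubfunctor`. -/
def coinducedSubfunctorι (Φ : C ⥤ D) {S : D ⥤ ModuleCat.{w} R} {Y : C ⥤ ModuleCat.{w} R}
    (f : Y ⟶ Φ ⋙ S) : coinducedSubfunctor Φ f ⟶ S where
  app d := ModuleCat.ofHom (Submodule.subtype _)

instance (Φ : C ⥤ D) {S : D ⥤ ModuleCat.{w} R} {Y : C ⥤ ModuleCat.{w} R}
    (f : Y ⟶ Φ ⋙ S) : Mono (coinducedSubfunctorι Φ f) := by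
  have (d : D) : Mono ((coinducedSubfunctorι Φ f).app d) :=
    (ModuleCat.mono_iff_injective _).2 (Submodule.injective_subtype _)
  exact NatTrans.mono_of_mono_app _

/-- The identity of `Φ(c)` is one of the morphisms tested in the infimum. Together with
`exists_coinducedSubfunctor_eq`, this says that the subfunctor restricts along `Φ` to exactly the
image of `f`. -/
theorem mem_range_of_coinducedSubfunctor (Φ : C ⥤ D) {S : D ⥤ ModuleCat.{w} R}
    {Y : C ⥤ ModuleCat.{w} R} (f : Y ⟶ Φ ⋙ S) {c : C}
    (x : (coinducedSubfunctor Φ f).obj (Φ.obj c)) :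
    ∃ y, f.app c y = (coinducedSubfunctorι Φ f).app (Φ.obj c) x := by
  have hx := x.2
  simp only [Submodule.mem_iInf] at hx
  obtain ⟨y, hy⟩ := hx c (𝟙 _)
  exact ⟨y, hy.trans (ConcreteCategory.congr_hom (S.map_id _) x.1)⟩

/-- Fullness is what matters here: each test morphism `Φ(c) ⟶ Φ(c')` lifts to `C`, and the image of
`f` is stable under morphisms of `C` by naturality. -/
theorem exists_coinducedSubfunctor_eq (Φ : C ⥤ D) [Φ.Full] {S : D ⥤ ModuleCat.{w} R}
    {Y : C ⥤ ModuleCat.{w} R} (f : Y ⟶ Φ ⋙ S) {c : C} (y : Y.obj c) :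
    ∃ x, (coinducedSubfunctorι Φ f).app (Φ.obj c) x = f.app c y := by
  refine ⟨⟨f.app c y, ?_⟩, rfl⟩
  simp only [Submodule.mem_iInf]
  intro c' m
  refine ⟨Y.map (Φ.preimage m) y, ?_⟩
  simp

/-- Precomposition with a full functor such that every object of the target is a retract of an
object in its image preserves simple functors to a category of modules. -/
theorem simple_whiskeringLeft_obj (Φ : C ⥤ D) [Φ.Full]
    (hΦ : ∀ d : D, ∃ c : C, Nonempty (Retract d (Φ.obj c))) (S : D ⥤ ModuleCat.{w} R) [Simple S] :
    Simple (((whiskeringLeft C D (ModuleCat.{w} R)).obj Φ).obj S) where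
  mono_isIso_iff_nonzero {Y} f _ := by
    have hf : ∀ c, Mono (f.app c) := (NatTrans.mono_iff_mono_app f).1 inferInstance
    constructor
    -- If zero were an isomorphism, the identity of the restriction of `S` would vanish, hence by
    -- faithfulness that of `S`.
    · rintro _ rfl
      have h0 : 𝟙 (((whiskeringLeft C D (ModuleCat.{w} R)).obj Φ).obj S) = 0 := by
        rw [← IsIso.inv_hom_id (0 : Y ⟶ _), comp_zero]
      have := faithful_whiskeringLeft_obj (A := ModuleCat.{w} R) Φ hΦ
      refine id_nonzero S (((whiskeringLeft C D (ModuleCat.{w} R)).obj Φ).map_injective ?_)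
      rw [Functor.map_id, h0]
      rfl
    · intro hne
      -- The subfunctor of `S` restricts to the image of `f`, so it is nonzero; simplicity makes it
      -- all of `S`, and `f` is then surjective at every object.
      have hι : coinducedSubfunctorι Φ f ≠ 0 := by
        intro h0
        refine hne ?_
        ext c y
        obtain ⟨x, hx⟩ := exists_coinducedSubfunctor_eq Φ f y
        rw [← hx, h0]
        rfl
      have := isIso_of_mono_of_nonzero hι
      have (c : C) : IsIso (f.app c) := by
        have : Epi (f.app c) := by
          rw [ModuleCat.epi_iff_surjective]
          intro z
          obtain ⟨x, rfl⟩ := (ModuleCat.epi_iff_surjective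
            ((coinducedSubfunctorι Φ f).app (Φ.obj c))).1 inferInstance z
          exact mem_range_of_coinducedSubfunctor Φ f x
        exact isIso_of_mono_of_epi _
      exact NatIso.isIso_of_isIso_app f

end CategoryTheory.Functor

/-! ### Embeddings and amalgams of quadratic spaces -/

namespace QSpace

/-- Every quadratic space embeds in a non-degenerate one. -/
theorem exists_hom_nondeg (V : QSpace) : ∃ (X : NSpace), Nonempty (V ⟶ X.toQSpace) := by
  -- The form `b` need not be symmetric, so characteristic 2 is no obstacle. The embedding is `x ↦
  -- (b(x, ·), x)`: the hyperbolic form `(φ, v) ↦ φ(v)` takes the value `b(x, x)` there.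
  obtain ⟨b, hb⟩ := LinearMap.BilinMap.toQuadraticMap_surjective V.form
  refine ⟨⟨⟨Module.Dual (ZMod 2) V × V, QuadraticForm.dualProd (ZMod 2) V⟩, ?_⟩,
    ⟨⟨⟨b.prod .id, ?_⟩, ?_⟩⟩⟩
  · intro x hx
    -- Non-degeneracy of the hyperbolic form reduces to injectivity of `V → V**`.
    refine (LinearMap.separatingLeft_dualProd (ZMod 2) V).2
      (Module.eval_apply_injective (ZMod 2)) x fun y => ?_
    refine Eq.trans ?_ (hx y)
    simp [QuadraticMap.polar]
    abel
  · intro x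
    rw [← hb]
    rfl
  · intro x y h
    exact congrArg Prod.snd h

/-- Any two embeddings of a quadratic space in quadratic spaces `V` and `W` are the projections of
a pullback `V ×[P] W`. -/
theorem exists_isPullback {D V W : QSpace} (f : D ⟶ V) (g : D ⟶ W) :
    ∃ (P : QSpace) (l : V ⟶ P) (r : W ⟶ P), IsPullback f g l r := by
  -- The retractions `p` and `s` are only linear; they choose complements of `D` in `V` and in `W`.
  obtain ⟨p, hp⟩ := f.isometry.toLinearMap.exists_leftInverse_of_injective
    (LinearMap.ker_eq_bot.2 f.injective)
  obtain ⟨s, hs⟩ := g.isometry.toLinearMap.exists_leftInverse_of_injective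
    (LinearMap.ker_eq_bot.2 g.injective)
  have hp : ∀ d, p (f d) = d := fun d => DFunLike.congr_fun hp d
  have hs : ∀ d, s (g d) = d := fun d => DFunLike.congr_fun hs d
  let F : D →ₗ[ZMod 2] V := f.isometry.toLinearMap
  let G : D →ₗ[ZMod 2] W := g.isometry.toLinearMap
  -- This cross term lets `v` pair with the complement `ker s` of `D` in `W` through its component
  -- `p v` in `D`, as that component does inside `W`. The amalgam is `V × ker s`; keeping the whole
  -- of `V × W` is harmless, as degeneracy is allowed.
  let b : LinearMap.BilinForm (ZMod 2) (V × W) :=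
    (W.bil ∘ₗ G ∘ₗ p ∘ₗ LinearMap.fst (ZMod 2) V W).compl₂ (LinearMap.snd (ZMod 2) V W)
  let P : QSpace := ⟨V × W, V.form.prod W.form + b.toQuadraticMap⟩
  have hP : ∀ v w, P.form (v, w) = V.form v + W.form w + W.bil (g (p v)) w := fun v w => rfl
  let l : V ⟶ P := ⟨⟨LinearMap.inl (ZMod 2) V W, fun v => (hP v 0).trans (by simp)⟩,
    LinearMap.inl_injective⟩
  -- The decomposition `w = g(s w) + (w - g(s w))` is used, with the first summand sent into `V`.
  -- Since `p ∘ f = 𝟙`, the cross term at `r w` is the polar term between these two summands.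
  let r : W ⟶ P := ⟨⟨(F ∘ₗ s).prod (.id - G ∘ₗ s), fun w => (hP (f (s w)) (w - g (s w))).trans (by
    have h := W.form_add (w - g (s w)) (g (s w))
    rw [sub_add_cancel, form_map] at h
    rw [h, form_map, hp, W.bil_comm]
    ring)⟩, fun x y h => by
      obtain ⟨h₁, h₂⟩ := Prod.ext_iff.1 h
      have h₁ : s x = s y := f.injective h₁
      have h₂ : x - g (s x) = y - g (s y) := h₂
      rw [h₁] at h₂
      exact sub_left_injective h₂⟩
  have hl : ∀ v, l v = ((v, 0) : V × W) := fun _ => rfl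
  have hr : ∀ w, r w = ((f (s w), w - g (s w)) : V × W) := fun _ => rfl
  refine ⟨P, l, r, isPullback_of (hom_ext fun d => ?_) fun v w h => ?_⟩
  · rw [comp_apply, comp_apply, hl, hr, hs, sub_self]
  -- Equality of `(v, 0)` and `(f(s w), w - g(s w))` means that `w` lies in `g(D)` and that `v` is
  -- the image of the same element `s w`.
  · rw [hl, hr] at h
    obtain ⟨h₁, h₂⟩ := Prod.ext_iff.1 h
    exact ⟨s w, h₁.symm, (sub_eq_zero.1 (show w - g (s w) = 0 from h₂.symm)).symm⟩

instance mono_hom {V W : QSpace} (f : V ⟶ W) : Mono f :=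
  ⟨fun _ _ h => hom_ext fun x => hom_injective f (DFunLike.congr_fun h x)⟩

/-- An embedding makes its source a retract of its target in the category of spans. -/
def spanRetract {V W : QSpace} (f : V ⟶ W) : Retract (SpanCat.of V) (SpanCat.of W) where
  i := SpanCat.cls (𝟙 V) f
  r := SpanCat.cls f (𝟙 V)
  -- The kernel pair of a monomorphism is trivial, so the pullback computing the composite is `V`
  -- itself.
  retract := (SpanCat.comp_eq_of_isPullback (IsKernelPair.id_of_mono f)).trans (by simp; rfl)

end QSpace

/-! ### Fullness of `σ`, retracts, and the theorem -/

/-- Every span between non-degenerate spaces comes from a pullback over a non-degenerate space. -/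
theorem full_sigma : sigma.Full where
  map_surjective {V W} S := by
    obtain ⟨S⟩ := S
    induction S using SpanCat.Hom.ind with
    | h D f g =>
      obtain ⟨P, l, r, h⟩ := QSpace.exists_isPullback f g
      obtain ⟨X, ⟨i⟩⟩ := P.exists_hom_nondeg
      let l' : V.base ⟶ X := (l ≫ i).isometry
      let r' : W.base ⟶ X := (r ≫ i).isometry
      have h' : IsPullback f g (NSpace.incl.map l') (NSpace.incl.map r') :=
        -- Enlarging the base along the monomorphism `i` does not change the pullback.
        IsPullback.of_isLimit (PullbackCone.isLimitOfCompMono l r i _ h.isLimit)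
      exact ⟨TCat.cls l' r', ObjectProperty.hom_ext _ (sigmaMap_cls h')⟩

/-- Every object of `Sp(E_q^deg)` is a retract of a non-degenerate space. -/
theorem exists_retract_sigma (D : SpanCat QSpace) :
    ∃ V : TCat, Nonempty (Retract D ((sigma ⋙ ObjectProperty.ι _).obj V)) := by
  obtain ⟨D⟩ := D
  obtain ⟨X, ⟨i⟩⟩ := D.exists_hom_nondeg
  exact ⟨.of X, ⟨QSpace.spanRetract i⟩⟩

/-- The functor `κ` from `F_iso` to `F_quad` given by precomposition with `σ` is exact, is (strong,
symmetric) monoidal for the pointwise tensor products, is fully faithful and preserves simple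
objects. -/
theorem theorem4p1 :
    (kappa.Additive ∧ PreservesFiniteLimits kappa ∧ PreservesFiniteColimits kappa) ∧
    Nonempty kappa.Braided ∧
    (kappa.Full ∧ kappa.Faithful) ∧
    (∀ S : Fiso, Simple S → Simple (kappa.obj S)) := by
  have := full_sigma
  -- Merging the two restrictions matters: the retract hypothesis concerns the whole composite into
  -- `Sp(E_q^deg)`.
  have h : kappa = (Functor.whiskeringLeft TCat (SpanCat QSpace) Vect).obj
    (sigma ⋙ ObjectProperty.ι _) := rfl
  rw [h]
  exact ⟨⟨⟨fun {_ _ _ _} => rfl⟩, ⟨fun _ _ _ => inferInstance⟩, ⟨fun _ _ _ => inferInstance⟩⟩,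
    Functor.nonempty_braided_whiskeringLeft_obj _,
    ⟨Functor.full_whiskeringLeft_obj _ exists_retract_sigma,
      Functor.faithful_whiskeringLeft_obj _ exists_retract_sigma⟩,
    fun S _ => Functor.simple_whiskeringLeft_obj _ exists_retract_sigma S⟩
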